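/- Let $q>2$ be a prime power and let $K$ be a finite field containing $\mathbb F_q$ (for instance $K=\mathbb F_q$ or $K=\mathbb F_{q^2}$). Let $x_0$ be transcendental over $K$, let $x_1,x_2,\dots$ be elements of an extension field of $K(x_0)$ with $$x_{i+1}^{\,q-1}+(x_i+1)^{q-1}=1\qquad(i\ge 0),$$ and put $F_n=K(x_0,\dots,x_n)$ for $n\ge 0$. Let $\alpha\in\mathbb F_q\setminus\{-1\}$ and let $P_\alpha$ be the zero of $x_0-\alpha$ in $F_0=K(x_0)$. Then $P_\alpha$ is totally ramified in $F_{n+1}/F_n$ for every $n\ge 0$; that is, for every $n\ge 0$ and every place $P$ of $F_n$ lying above $P_\alpha$, the extension $F_{n+1}/F_n$ is finite, there is exactly one place $Q$ of $F_{n+1}$ above $P$, and its ramification index is $e(Q|P)=[F_{n+1}:F_n]$. -/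

import Mathlib

/-- A place of `F/K`, given by its valuation ring: a valuation ring `𝒪` of the field `F` with
`K ⊆ 𝒪 ⊊ F`. (If `𝒪 = K`, then every `z : F` or its inverse lies in `K`, so `𝒪 = F`; hence
`K ≠ 𝒪` is automatic.) The place itself is the maximal ideal of `𝒪`. -/
structure FunctionFieldPlace (K F : Type*) [Field K] [Field F] [Algebra K F] where
  /-- The valuation ring of the place. -/
  ring : ValuationSubring F
  algebraMap_mem : ∀ a : K, algebraMap K F a ∈ ring
  ne_top : ring ≠ ⊤

namespace FunctionFieldPlace

section

variable {K F F' : Type*} [Field K] [Field F] [Field F'] [Algebra K F] [Algebra K F']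

/-- The place `P`, that is, the maximal ideal of its valuation ring. -/
noncomputable def ideal (P : FunctionFieldPlace K F) : Ideal P.ring :=
  IsLocalRing.maximalIdeal P.ring

/-- `P` is a zero of `z`: the function `z` lies in the valuation ring of `P` and in its maximal
ideal. -/
def IsZero (P : FunctionFieldPlace K F) (z : F) : Prop :=
  ∃ h : z ∈ P.ring, (⟨z, h⟩ : P.ring) ∈ P.ideal

/-- For an extension `φ : F → F'` of fields over `K`, the place `Q` of `F'` lies above the place
`P` of `F`: the valuation ring of `P` is the intersection of that of `Q` with `F`. -/
def LiesAbove (φ : F →ₐ[K] F') (Q : FunctionFieldPlace K F') (P : FunctionFieldPlace K F) : Prop :=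
  Q.ring.comap (φ : F →+* F') = P.ring

/-- The inclusion of valuation rings `𝒪_P → 𝒪_Q` for `Q` above `P`. -/
def LiesAbove.ringHom {φ : F →ₐ[K] F'} {Q : FunctionFieldPlace K F'} {P : FunctionFieldPlace K F}
    (h : LiesAbove φ Q P) : P.ring →+* Q.ring :=
  (φ : F →+* F').restrict P.ring Q.ring fun z hz => by
    have hz' : z ∈ Q.ring.comap (φ : F →+* F') := by rw [h]; exact hz
    exact hz'

/-- The ramification index `e(Q|P)`: the largest `e` with `P 𝒪_Q ⊆ Q ^ e`. -/
noncomputable def LiesAbove.ramificationIndex {φ : F →ₐ[K] F'} {Q : FunctionFieldPlace K F'}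
    {P : FunctionFieldPlace K F} (h : LiesAbove φ Q P) : ℕ :=
  letI : Algebra P.ring Q.ring := h.ringHom.toAlgebra
  Ideal.ramificationIdx' P.ideal Q.ideal

/-- The degree `[F' : F]` of the extension `φ : F → F'`
(used only together with finiteness of the extension). -/
noncomputable def extensionDegree (φ : F →ₐ[K] F') : ℕ :=
  letI : Algebra F F' := (φ : F →+* F').toAlgebra
  Module.finrank F F'

/-- `P` is totally ramified in the finite extension `φ : F → F'`: there is exactly one place `Q` of
`F'` above `P`, and its ramification index is `e(Q|P) = [F' : F]`. -/
def IsTotallyRamified (φ : F →ₐ[K] F') (P : FunctionFieldPlace K F) : Prop :=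
  (φ : F →+* F').Finite ∧
    ∃ Q : FunctionFieldPlace K F', ∃ h : LiesAbove φ Q P,
      (∀ Q' : FunctionFieldPlace K F', LiesAbove φ Q' P → Q' = Q) ∧
        h.ramificationIndex = extensionDegree φ

end

end FunctionFieldPlace

/-- The field `F_n = K(x_0, …, x_n)` inside `E`. -/
def towerField (K : Type*) {E : Type*} [Field K] [Field E] [Algebra K E] (x : ℕ → E) (n : ℕ) :
    IntermediateField K E :=
  IntermediateField.adjoin K {y | ∃ i ≤ n, y = x i}

theorem mem_towerField (K : Type*) {E : Type*} [Field K] [Field E] [Algebra K E] (x : ℕ → E)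
    {i n : ℕ} (h : i ≤ n) : x i ∈ towerField K x n :=
  IntermediateField.subset_adjoin K _ ⟨i, h, rfl⟩

theorem towerField_mono (K : Type*) {E : Type*} [Field K] [Field E] [Algebra K E] (x : ℕ → E)
    {m n : ℕ} (h : m ≤ n) : towerField K x m ≤ towerField K x n :=
  IntermediateField.adjoin.mono K _ _ fun _ ⟨i, hi, hy⟩ => ⟨i, hi.trans h, hy⟩

/-- The inclusion `F_m → F_n` for `m ≤ n`. -/
def towerInclusion (K : Type*) {E : Type*} [Field K] [Field E] [Algebra K E] (x : ℕ → E)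
    {m n : ℕ} (h : m ≤ n) : towerField K x m →ₐ[K] towerField K x n :=
  IntermediateField.inclusion (towerField_mono K x h)

/-! The induction carries one invariant: at every place of `F_n` above `P_α`, some `x_n - c` with `c
∈ 𝔽_q`, `c ≠ -1`, is a uniformizer (`isUniformizer_towerField`). Put `t = x_n - c` and `d = c + 1`,
so `d ^ q = d`. Additivity of Frobenius gives `(t + d) * (1 - (t + d) ^ (q - 1)) = t * (1 - t ^ (q -
1))`. Both `t + d` and `1 - t ^ (q - 1)` are units at the place, so `x_{n+1} ^ (q - 1) = 1 - (x_n +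
1) ^ (q - 1)` is again a uniformizer (`isUniformizer_one_sub_pow`).

Adjoining an `m`-th root `y` of a uniformizer is totally ramified of degree `m`
(`isTotallyRamified_of_pow_eq`), and `y` is a uniformizer above. Hence the invariant passes to
`F_{n+1}` with `c = 0`. The radical step compares values modulo `m`, so it needs neither roots of
unity nor separability. -/

namespace ValuationSubring

/-! ### Discrete valuation rings and extension of valuation rings. -/

section

variable {F F' : Type*} [Field F] [Field F'] [Algebra F F']

/-- `t` is a uniformizer of the discrete valuation ring `O`. -/
def IsUniformizer (O : ValuationSubring F) (t : F) : Prop :=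
  t ≠ 0 ∧ O.valuation t < 1 ∧ ∀ z : F, z ≠ 0 → ∃ k : ℤ, O.valuation z = O.valuation t ^ k

theorem IsUniformizer.congr {O : ValuationSubring F} {t w : F} (ht : O.IsUniformizer t)
    (h : O.valuation w = O.valuation t) : O.IsUniformizer w := by
  obtain ⟨h0, h1, h2⟩ := ht
  refine ⟨?_, h ▸ h1, fun z hz => h ▸ h2 z hz⟩
  rw [← O.valuation.ne_zero_iff, h]
  exact O.valuation.ne_zero_iff.2 h0

/-- Chevalley's extension theorem: a valuation ring dominating the image of `O` in `F'` cannot meet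
`F` in more than `O`. -/
theorem exists_comap_algebraMap_eq (F' : Type*) [Field F'] [Algebra F F']
    (O : ValuationSubring F) :
    ∃ V : ValuationSubring F', V.comap (algebraMap F F') = O := by
  obtain ⟨V, hle, hloc⟩ := (LocalSubring.range
    ((algebraMap F F').comp O.subtype)).exists_le_valuationSubring
  have hOV : ∀ z ∈ O, algebraMap F F' z ∈ V := fun z hz => hle ⟨⟨z, hz⟩, rfl⟩
  refine ⟨V, ?_⟩
  ext z
  rw [mem_comap]
  refine ⟨fun hz => ?_, hOV z⟩
  by_contra hzO
  have hz0 : z ≠ 0 := by rintro rfl; exact hzO O.zero_mem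
  have hinv : z⁻¹ ∈ O := (O.mem_or_inv_mem z).resolve_left hzO
  -- Both `z` and `z⁻¹` lie in `V`, so `z⁻¹` is a unit there; domination makes it a unit of `O`
  -- already.
  have hu := hloc.map_nonunit ⟨algebraMap F F' z⁻¹, ⟨⟨z⁻¹, hinv⟩, rfl⟩⟩
    (.of_mul_eq_one (⟨algebraMap F F' z, hz⟩ : V.toLocalSubring.toSubring) (Subtype.ext (by
      change algebraMap F F' z⁻¹ * algebraMap F F' z = 1
      rw [← map_mul, inv_mul_cancel₀ hz0, map_one])))
  obtain ⟨⟨_, ⟨w, rfl⟩⟩, hw⟩ := hu.exists_right_inv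
  have hw' : algebraMap F F' z⁻¹ * algebraMap F F' w = 1 := congrArg Subtype.val hw
  rw [← map_mul, map_eq_one_iff _ (algebraMap F F').injective,
    inv_mul_eq_one₀ hz0] at hw'
  exact hzO (hw' ▸ w.2)

/-- The two valuations have different value groups, so they can be compared only up to equivalence.
-/
theorem isEquiv_comap_valuation {O : ValuationSubring F} {V : ValuationSubring F'}
    (h : V.comap (algebraMap F F') = O) :
    (V.valuation.comap (algebraMap F F')).IsEquiv O.valuation := by
  refine Valuation.isEquiv_of_val_le_one fun z => ?_
  rw [Valuation.comap_apply, valuation_le_one_iff, valuation_le_one_iff, ← h, mem_comap]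

/-! ### Adjoining an `m`-th root of a uniformizer. -/

section Radical

variable {O : ValuationSubring F} {V : ValuationSubring F'} {t : F} {y : F'} {m : ℕ}

theorem valuation_pos_of_pow_eq (ht : O.IsUniformizer t) (hm : m ≠ 0)
    (hy : y ^ m = algebraMap F F' t) : 0 < V.valuation y := by
  rw [zero_lt_iff, Valuation.ne_zero_iff]
  rintro rfl
  rw [zero_pow hm, eq_comm, map_eq_zero] at hy
  exact ht.1 hy

theorem valuation_lt_one_of_pow_eq (hV : V.comap (algebraMap F F') = O) (ht : O.IsUniformizer t)
    (hy : y ^ m = algebraMap F F' t) : V.valuation y < 1 := by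
  have h : V.valuation (y ^ m) < 1 := by
    rw [hy]
    exact (isEquiv_comap_valuation hV).lt_one_iff_lt_one.2 ht.2.1
  rw [map_pow] at h
  by_contra! h1
  exact (one_le_pow₀ h1).not_gt h

theorem valuation_algebraMap_eq_zpow (hV : V.comap (algebraMap F F') = O)
    (ht : O.IsUniformizer t) (hy : y ^ m = algebraMap F F' t) {z : F} (hz : z ≠ 0) :
    ∃ k : ℤ, V.valuation (algebraMap F F' z) = V.valuation y ^ ((m : ℤ) * k) := by
  obtain ⟨k, hk⟩ := ht.2.2 z hz
  refine ⟨k, ?_⟩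
  rw [← map_zpow₀] at hk
  have := (isEquiv_comap_valuation hV).eq_iff.2 hk
  rw [Valuation.comap_apply, Valuation.comap_apply, map_zpow₀, ← hy, ← zpow_natCast,
    ← zpow_mul, map_zpow₀] at this
  exact this

theorem valuation_smul_pow_eq_zpow (hV : V.comap (algebraMap F F') = O)
    (ht : O.IsUniformizer t) (hm : m ≠ 0) (hy : y ^ m = algebraMap F F' t) {z : F} (hz : z ≠ 0)
    (i : ℕ) : ∃ k : ℤ, V.valuation (z • y ^ i) = V.valuation y ^ ((m : ℤ) * k + i) := by
  obtain ⟨k, hk⟩ := valuation_algebraMap_eq_zpow hV ht hy hz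
  refine ⟨k, ?_⟩
  rw [zpow_add₀ (valuation_pos_of_pow_eq ht hm hy).ne', Algebra.smul_def, map_mul, map_pow, hk,
    zpow_natCast]

/-- The valuation of a nonzero polynomial of degree `< m` in `y` is attained by one of its terms. -/
theorem exists_valuation_sum_eq (hV : V.comap (algebraMap F F') = O)
    (ht : O.IsUniformizer t) (hm : m ≠ 0) (hy : y ^ m = algebraMap F F' t) {a : Fin m → F}
    (ha : a ≠ 0) :
    ∃ j, a j ≠ 0 ∧ V.valuation (∑ i, a i • y ^ (i : ℕ)) = V.valuation (a j • y ^ (j : ℕ)) ∧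
      ∀ i, V.valuation (a i • y ^ (i : ℕ)) ≤ V.valuation (a j • y ^ (j : ℕ)) := by
  have hpos := valuation_pos_of_pow_eq (V := V) ht hm hy
  have hlt := valuation_lt_one_of_pow_eq hV ht hy
  have hy0 : y ≠ 0 := V.valuation.ne_zero_iff.1 hpos.ne'
  obtain ⟨l, hl⟩ := Function.ne_iff.1 ha
  obtain ⟨j, -, hj⟩ := Finset.exists_max_image Finset.univ
    (fun i : Fin m => V.valuation (a i • y ^ (i : ℕ))) ⟨l, Finset.mem_univ _⟩
  have haj : a j ≠ 0 := by
    intro h0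
    have := hj l (Finset.mem_univ _)
    rw [h0, zero_smul, map_zero, le_zero_iff, Valuation.zero_iff] at this
    exact smul_ne_zero hl (pow_ne_zero _ hy0) this
  refine ⟨j, haj, Valuation.map_sum_eq_of_lt _ (Finset.mem_univ j) fun i hi => ?_,
    fun i => hj i (Finset.mem_univ _)⟩
  -- Two nonzero terms never tie: the exponents of `V.valuation y` are congruent to `i` and `j`
  -- modulo `m`, and `i`, `j` are distinct and below `m`.
  refine lt_of_le_of_ne (hj i (Finset.mem_univ _)) fun heq => ?_
  have hij : i ≠ j := by simpa using hi
  have hai : a i ≠ 0 := by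
    intro h0
    rw [h0, zero_smul, map_zero, eq_comm, Valuation.zero_iff] at heq
    exact smul_ne_zero haj (pow_ne_zero _ hy0) heq
  obtain ⟨k, hk⟩ := valuation_smul_pow_eq_zpow hV ht hm hy hai i
  obtain ⟨k', hk'⟩ := valuation_smul_pow_eq_zpow hV ht hm hy haj j
  rw [hk, hk'] at heq
  have hexp : (m : ℤ) * k + i = m * k' + j := zpow_right_injective₀ hpos hlt.ne heq
  have hmod := congrArg (· % (m : ℤ)) hexp
  simp only [Int.mul_add_emod_self_left] at hmod
  rw [Int.emod_eq_of_lt (by positivity) (by exact_mod_cast i.2),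
    Int.emod_eq_of_lt (by positivity) (by exact_mod_cast j.2)] at hmod
  exact hij (Fin.ext (by exact_mod_cast hmod))

theorem linearIndependent_pow_of_pow_eq (hV : V.comap (algebraMap F F') = O)
    (ht : O.IsUniformizer t) (hm : m ≠ 0) (hy : y ^ m = algebraMap F F' t) :
    LinearIndependent F fun i : Fin m => y ^ (i : ℕ) := by
  rw [Fintype.linearIndependent_iff]
  intro a ha
  by_contra! h
  have ha0 : a ≠ 0 := fun h0 => h.elim fun i hi => hi (congrFun h0 i)
  obtain ⟨j, hj, hsum, -⟩ := exists_valuation_sum_eq hV ht hm hy ha0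
  rw [ha, map_zero, eq_comm, Valuation.zero_iff] at hsum
  exact smul_ne_zero hj (pow_ne_zero _ (V.valuation.ne_zero_iff.1
    (valuation_pos_of_pow_eq ht hm hy).ne')) hsum

/-- The value of `a` is the power `m * k` of that of `y`, and `m * k + i ≥ 0` with `i < m` forces `k
≥ 0`. -/
theorem mem_of_smul_pow_mem (hV : V.comap (algebraMap F F') = O)
    (ht : O.IsUniformizer t) (hy : y ^ m = algebraMap F F' t) {a : F} (i : Fin m)
    (h : a • y ^ (i : ℕ) ∈ V) : a ∈ O := by
  by_cases ha : a = 0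
  · exact ha ▸ O.zero_mem
  have hm : m ≠ 0 := i.pos.ne'
  have hpos := valuation_pos_of_pow_eq (V := V) ht hm hy
  have hlt := valuation_lt_one_of_pow_eq hV ht hy
  have h1 := (V.valuation_le_one_iff _).2 h
  obtain ⟨k, hk⟩ := valuation_algebraMap_eq_zpow hV ht hy ha
  rw [← hV, mem_comap, ← valuation_le_one_iff, hk, zpow_le_one_iff_right_of_lt_one₀ hpos hlt]
  rw [Algebra.smul_def, map_mul, hk, map_pow, ← zpow_natCast, ← zpow_add₀ hpos.ne',
    zpow_le_one_iff_right_of_lt_one₀ hpos hlt] at h1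
  by_contra! hneg
  have hi : (i : ℤ) < m := by exact_mod_cast i.2
  have hm' : (0 : ℤ) < m := by exact_mod_cast i.pos
  have hk : k ≤ -1 := by
    by_contra! hk
    exact hneg.not_ge (mul_nonneg hm'.le (by lia))
  nlinarith

theorem sum_smul_pow_mem_iff (hV : V.comap (algebraMap F F') = O)
    (ht : O.IsUniformizer t) (hm : m ≠ 0) (hy : y ^ m = algebraMap F F' t) (a : Fin m → F) :
    ∑ i, a i • y ^ (i : ℕ) ∈ V ↔ ∀ i, a i ∈ O := by
  constructor
  · intro h i
    by_cases ha : a = 0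
    · exact ha ▸ O.zero_mem
    obtain ⟨j, -, hsum, hj⟩ := exists_valuation_sum_eq hV ht hm hy ha
    refine mem_of_smul_pow_mem hV ht hy i ((V.valuation_le_one_iff _).1 ((hj i).trans ?_))
    rw [← hsum]
    exact (V.valuation_le_one_iff _).2 h
  · intro h
    have hyV : y ∈ V := (V.valuation_le_one_iff _).1 (valuation_lt_one_of_pow_eq hV ht hy).le
    refine sum_mem fun i _ => ?_
    rw [Algebra.smul_def]
    refine V.mul_mem _ _ ?_ (pow_mem hyV _)
    have := h i
    rwa [← hV, mem_comap] at this

theorem exists_sum_smul_pow_eq (hm : m ≠ 0) (hy : y ^ m = algebraMap F F' t)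
    (htop : IntermediateField.adjoin F {y} = ⊤) (z : F') :
    ∃ a : Fin m → F, ∑ i, a i • y ^ (i : ℕ) = z := by
  have hmonic : (Polynomial.X ^ m - Polynomial.C t).Monic := Polynomial.monic_X_pow_sub_C t hm
  have hroot : Polynomial.aeval y (Polynomial.X ^ m - Polynomial.C t) = 0 := by simp [hy]
  have hint : IsIntegral F y := ⟨_, hmonic, hroot⟩
  have hz : z ∈ (IntermediateField.adjoin F {y}).toSubalgebra := by
    rw [htop]; exact Algebra.mem_top
  rw [IntermediateField.adjoin_simple_toSubalgebra_of_isAlgebraic hint.isAlgebraic,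
    Algebra.adjoin_singleton_eq_range_aeval] at hz
  obtain ⟨p, rfl⟩ := hz
  refine ⟨fun i => (p %ₘ (Polynomial.X ^ m - Polynomial.C t)).coeff i, ?_⟩
  have hdeg : (p %ₘ (Polynomial.X ^ m - Polynomial.C t)).natDegree < m := by
    have := Polynomial.natDegree_modByMonic_lt p hmonic (fun h => by
      have := congrArg Polynomial.natDegree h
      rw [Polynomial.natDegree_X_pow_sub_C, Polynomial.natDegree_one] at this
      exact hm this)
    rwa [Polynomial.natDegree_X_pow_sub_C] at this
  change _ = Polynomial.aeval y p
  rw [← Polynomial.aeval_modByMonic_eq_self_of_root hroot, Polynomial.aeval_eq_sum_range' hdeg,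
    Finset.sum_range]

/-- The basis `1, y, …, y ^ (m - 1)` of `F(y)`, where `y ^ m` is a uniformizer of `F`. -/
noncomputable def basisPowOfPowEq (hV : V.comap (algebraMap F F') = O)
    (ht : O.IsUniformizer t) (hm : m ≠ 0) (hy : y ^ m = algebraMap F F' t)
    (htop : IntermediateField.adjoin F {y} = ⊤) : Module.Basis (Fin m) F F' :=
  .mk (linearIndependent_pow_of_pow_eq hV ht hm hy) fun z _ => by
    obtain ⟨a, rfl⟩ := exists_sum_smul_pow_eq hm hy htop z
    exact sum_mem fun i _ => Submodule.smul_mem _ _ (Submodule.subset_span ⟨i, rfl⟩)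

/-- By `sum_smul_pow_mem_iff`, membership depends only on whether the coefficients lie in `O`, a
criterion that does not involve `V`. -/
theorem eq_of_comap_eq_of_pow_eq {V' : ValuationSubring F'}
    (hV : V.comap (algebraMap F F') = O) (hV' : V'.comap (algebraMap F F') = O)
    (ht : O.IsUniformizer t) (hm : m ≠ 0) (hy : y ^ m = algebraMap F F' t)
    (htop : IntermediateField.adjoin F {y} = ⊤) : V' = V := by
  ext z
  obtain ⟨a, rfl⟩ := exists_sum_smul_pow_eq hm hy htop z
  rw [sum_smul_pow_mem_iff hV ht hm hy, sum_smul_pow_mem_iff hV' ht hm hy]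

theorem isUniformizer_of_pow_eq (hV : V.comap (algebraMap F F') = O)
    (ht : O.IsUniformizer t) (hm : m ≠ 0) (hy : y ^ m = algebraMap F F' t)
    (htop : IntermediateField.adjoin F {y} = ⊤) : V.IsUniformizer y := by
  refine ⟨V.valuation.ne_zero_iff.1 (valuation_pos_of_pow_eq ht hm hy).ne',
    valuation_lt_one_of_pow_eq hV ht hy, fun z hz => ?_⟩
  obtain ⟨a, rfl⟩ := exists_sum_smul_pow_eq hm hy htop z
  have ha : a ≠ 0 := by rintro rfl; simp at hz
  obtain ⟨j, hj, hsum, -⟩ := exists_valuation_sum_eq hV ht hm hy ha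
  obtain ⟨k, hk⟩ := valuation_smul_pow_eq_zpow hV ht hm hy hj j
  exact ⟨_, hsum.trans hk⟩

end Radical

theorem IsUniformizer.mem {O : ValuationSubring F} {t : F} (ht : O.IsUniformizer t) : t ∈ O :=
  (O.valuation_le_one_iff t).1 ht.2.1.le

theorem IsUniformizer.maximalIdeal_eq {O : ValuationSubring F} {t : F} (ht : O.IsUniformizer t) :
    IsLocalRing.maximalIdeal O = Ideal.span {⟨t, ht.mem⟩} := by
  have hpos : 0 < O.valuation t := zero_lt_iff.2 (O.valuation.ne_zero_iff.2 ht.1)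
  ext ⟨z, hz⟩
  rw [valuation_lt_one_iff, Ideal.mem_span_singleton']
  constructor
  · intro h
    by_cases hz0 : z = 0
    · exact ⟨0, Subtype.ext (by simp [hz0])⟩
    obtain ⟨k, hk⟩ := ht.2.2 z hz0
    change O.valuation z < 1 at h
    rw [hk, zpow_lt_one_iff_right_of_lt_one₀ hpos ht.2.1] at h
    refine ⟨⟨z / t, ?_⟩, Subtype.ext (div_mul_cancel₀ z ht.1)⟩
    rw [← valuation_le_one_iff, map_div₀, hk, div_eq_mul_inv, ← zpow_sub_one₀ hpos.ne',
      zpow_le_one_iff_right_of_lt_one₀ hpos ht.2.1]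
    lia
  · rintro ⟨c, hc⟩
    have : (z : F) = c * t := (congrArg Subtype.val hc).symm
    change O.valuation z < 1
    rw [this, map_mul]
    exact (mul_le_of_le_one_left' (O.valuation_le_one c)).trans_lt ht.2.1

end

end ValuationSubring

/-! ### Ramification of places and the uniformizers that occur. -/

namespace FunctionFieldPlace

section

variable {K F F' : Type*} [Field K] [Field F] [Field F'] [Algebra K F] [Algebra K F']

theorem eq_of_ring_eq {P Q : FunctionFieldPlace K F} (h : P.ring = Q.ring) : P = Q := by
  cases P
  cases Q
  cases h
  rfl

theorem LiesAbove.ramificationIndex_eq_of_pow_eq {φ : F →ₐ[K] F'} {Q : FunctionFieldPlace K F'}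
    {P : FunctionFieldPlace K F} (h : LiesAbove φ Q P) {t : F} {y : F'} {m : ℕ}
    (ht : P.ring.IsUniformizer t) (hyQ : Q.ring.IsUniformizer y) (hy : y ^ m = φ t) :
    h.ramificationIndex = m := by
  let : Algebra P.ring Q.ring := h.ringHom.toAlgebra
  have hmap : Ideal.map (algebraMap P.ring Q.ring) P.ideal = Ideal.span {⟨y, hyQ.mem⟩ ^ m} := by
    rw [ideal, ht.maximalIdeal_eq, Ideal.map_span, Set.image_singleton]
    congr 2
    exact Subtype.ext hy.symm
  have hideal : Q.ideal = Ideal.span {⟨y, hyQ.mem⟩} := hyQ.maximalIdeal_eq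
  have hy0 : (⟨y, hyQ.mem⟩ : Q.ring) ≠ 0 := fun h0 => hyQ.1 (congrArg Subtype.val h0)
  refine Ideal.ramificationIdx'_spec ?_ ?_
  · rw [hmap, hideal, Ideal.span_singleton_pow]
  -- As `y` is nonzero and not a unit, `y ^ (m + 1)` does not divide `y ^ m`.
  · rw [hmap, hideal, Ideal.span_singleton_pow, Ideal.span_singleton_le_span_singleton,
      pow_dvd_pow_iff hy0 fun hu => ?_]
    · lia
    · exact hyQ.2.1.ne ((Q.ring.valuation_eq_one_iff _).1 hu)

/-- Adjoining a root of order `m` of a uniformizer gives a totally ramified extension. -/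
theorem isTotallyRamified_of_pow_eq (φ : F →ₐ[K] F') (P : FunctionFieldPlace K F) {t : F} {y : F'}
    {m : ℕ} (ht : P.ring.IsUniformizer t) (hm : m ≠ 0) (hy : y ^ m = φ t)
    (htop : letI := (φ : F →+* F').toAlgebra; IntermediateField.adjoin F {y} = ⊤) :
    IsTotallyRamified φ P := by
  let : Algebra F F' := (φ : F →+* F').toAlgebra
  obtain ⟨V, hV⟩ := ValuationSubring.exists_comap_algebraMap_eq F' P.ring
  let b := ValuationSubring.basisPowOfPowEq hV ht hm hy htop
  have hmem (a : K) : algebraMap K F' a ∈ V := by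
    have := P.algebraMap_mem a
    rw [← hV, ValuationSubring.mem_comap] at this
    rwa [← φ.commutes]
  have hne : V ≠ ⊤ := by
    rintro rfl
    exact P.ne_top hV.symm
  let Q : FunctionFieldPlace K F' := ⟨V, hmem, hne⟩
  have hQ : LiesAbove φ Q P := hV
  refine ⟨Module.Finite.of_basis b, Q, hQ, fun Q' hQ' => ?_, ?_⟩
  · exact eq_of_ring_eq (ValuationSubring.eq_of_comap_eq_of_pow_eq hV hQ' ht hm hy htop)
  · rw [hQ.ramificationIndex_eq_of_pow_eq ht
      (ValuationSubring.isUniformizer_of_pow_eq hV ht hm hy htop) hy]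
    exact ((Module.finrank_eq_card_basis b).trans (Fintype.card_fin m)).symm

theorem LiesAbove.isUniformizer_of_pow_eq {φ : F →ₐ[K] F'} {Q : FunctionFieldPlace K F'}
    {P : FunctionFieldPlace K F} (h : LiesAbove φ Q P) {t : F} {y : F'} {m : ℕ}
    (ht : P.ring.IsUniformizer t) (hm : m ≠ 0) (hy : y ^ m = φ t)
    (htop : letI := (φ : F →+* F').toAlgebra; IntermediateField.adjoin F {y} = ⊤) :
    Q.ring.IsUniformizer y :=
  let _ : Algebra F F' := (φ : F →+* F').toAlgebra
  ValuationSubring.isUniformizer_of_pow_eq h ht hm hy htop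

/-- Restricting `Q` to `F'` gives the intermediate place; it is proper because its restriction to
`F` is. -/
theorem LiesAbove.exists_of_comp {F'' : Type*} [Field F''] [Algebra K F''] {φ : F →ₐ[K] F'}
    {ψ : F' →ₐ[K] F''} {Q : FunctionFieldPlace K F''} {P : FunctionFieldPlace K F}
    (h : LiesAbove (ψ.comp φ) Q P) :
    ∃ P' : FunctionFieldPlace K F', LiesAbove ψ Q P' ∧ LiesAbove φ P' P := by
  refine ⟨⟨Q.ring.comap (ψ : F' →+* F''), fun a => ?_, fun htop => P.ne_top ?_⟩, rfl, h⟩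
  · rw [ValuationSubring.mem_comap]
    have := Q.algebraMap_mem a
    rwa [← ψ.commutes] at this
  · have h' : (Q.ring.comap (ψ : F' →+* F'')).comap (φ : F →+* F') = P.ring := h
    rw [← h', htop]
    rfl

theorem valuation_algebraMap_eq_one (P : FunctionFieldPlace K F) {c : K} (hc : c ≠ 0) :
    P.ring.valuation (algebraMap K F c) = 1 := by
  refine le_antisymm ((P.ring.valuation_le_one_iff _).2 (P.algebraMap_mem c)) ?_
  have h := (P.ring.valuation_le_one_iff _).2 (P.algebraMap_mem c⁻¹)
  rw [map_inv₀, map_inv₀] at h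
  have hpos : 0 < P.ring.valuation (algebraMap K F c) :=
    zero_lt_iff.2 (P.ring.valuation.ne_zero_iff.2 ((map_ne_zero _).2 hc))
  exact (inv_le_one₀ hpos).1 h

theorem _root_.IntermediateField.adjoin_simple_sub_algebraMap (z : F) (c : K) :
    IntermediateField.adjoin K {z - algebraMap K F c} = IntermediateField.adjoin K {z} := by
  refine le_antisymm (IntermediateField.adjoin_simple_le_iff.2 ?_)
    (IntermediateField.adjoin_simple_le_iff.2 ?_)
  · exact sub_mem (IntermediateField.mem_adjoin_simple_self K z)
      (IntermediateField.algebraMap_mem _ c)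
  · have h := add_mem (IntermediateField.mem_adjoin_simple_self K (z - algebraMap K F c))
      (IntermediateField.algebraMap_mem _ c)
    rwa [sub_add_cancel] at h

theorem aeval_mem (P : FunctionFieldPlace K F) {z : F} (hz : z ∈ P.ring) (p : Polynomial K) :
    Polynomial.aeval z p ∈ P.ring := by
  rw [Polynomial.aeval_eq_sum_range]
  refine sum_mem fun i _ => ?_
  rw [Algebra.smul_def]
  exact P.ring.mul_mem _ _ (P.algebraMap_mem _) (pow_mem hz _)

/-- A zero of the generator `z` of a rational function field has `z` as uniformizer. -/
theorem isUniformizer_of_transcendental (P : FunctionFieldPlace K F) {z : F}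
    (hz : Transcendental K z) (hgen : IntermediateField.adjoin K {z} = ⊤)
    (hlt : P.ring.valuation z < 1) : P.ring.IsUniformizer z := by
  have hpoly : ∀ p : Polynomial K, p ≠ 0 →
      ∃ k : ℕ, P.ring.valuation (Polynomial.aeval z p) = P.ring.valuation z ^ k := by
    intro p hp
    -- Split off the power of `X`: the cofactor `r` has nonzero constant term, so `r(z)` is a
    -- nonzero constant plus a multiple of `z`, of value 1.
    obtain ⟨r, hr, hroot⟩ := Polynomial.exists_eq_pow_rootMultiplicity_mul_and_not_dvd p hp 0
    refine ⟨p.rootMultiplicity 0, ?_⟩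
    rw [map_zero, sub_zero, Polynomial.X_dvd_iff] at hroot
    have hr1 : P.ring.valuation (Polynomial.aeval z r) = 1 := by
      rw [← Polynomial.X_mul_divX_add r, map_add, map_mul, Polynomial.aeval_X,
        Polynomial.aeval_C, Valuation.map_add_eq_of_lt_right,
        P.valuation_algebraMap_eq_one hroot]
      rw [P.valuation_algebraMap_eq_one hroot, map_mul]
      refine (mul_le_of_le_one_right' ?_).trans_lt hlt
      exact (P.ring.valuation_le_one_iff _).2
        (P.aeval_mem ((P.ring.valuation_le_one_iff _).1 hlt.le) _)
    nth_rw 1 [hr]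
    rw [map_zero, sub_zero, map_mul, map_pow, Polynomial.aeval_X, map_mul, map_pow, hr1, mul_one]
  refine ⟨?_, hlt, fun w hw => ?_⟩
  · rintro rfl
    exact hz isAlgebraic_zero
  · have hwmem : w ∈ IntermediateField.adjoin K {z} := hgen ▸ IntermediateField.mem_top
    obtain ⟨p, r, rfl⟩ := (IntermediateField.mem_adjoin_simple_iff K w).1 hwmem
    obtain ⟨hp, hr⟩ := div_ne_zero_iff.1 hw
    obtain ⟨i, hi⟩ := hpoly p (by rintro rfl; simp at hp)
    obtain ⟨j, hj⟩ := hpoly r (by rintro rfl; simp at hr)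
    refine ⟨(i : ℤ) - j, ?_⟩
    rw [map_div₀, hi, hj, zpow_sub₀, zpow_natCast, zpow_natCast]
    rw [Valuation.ne_zero_iff]
    rintro rfl
    exact hz isAlgebraic_zero

end

/-- If `x - c` is a uniformizer and `c ^ q = c ≠ -1`, then so is `1 - (x + 1) ^ (q - 1)`. -/
theorem isUniformizer_one_sub_pow {k K F : Type*} [Field k] [Field K] [Field F] [Finite k]
    [Algebra k K] [Algebra K F] (P : FunctionFieldPlace K F) {c : k} (hc : c ≠ -1) {z : F}
    (hz : P.ring.IsUniformizer (z - algebraMap K F (algebraMap k K c))) :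
    P.ring.IsUniformizer (1 - (z + 1) ^ (Nat.card k - 1)) := by
  have := Fintype.ofFinite k
  rw [Nat.card_eq_fintype_card]
  have hq : 1 < Fintype.card k := Fintype.one_lt_card
  let : Algebra k F := ((algebraMap K F).comp (algebraMap k K)).toAlgebra
  set t := z - algebraMap K F (algebraMap k K c) with htdef
  set d : F := algebraMap K F (algebraMap k K (c + 1)) with hd
  have hzt : z + 1 = t + d := by rw [htdef, hd, map_add, map_add, map_one, map_one]; ring
  have hd1 : P.ring.valuation d = 1 := P.valuation_algebraMap_eq_one
    ((map_ne_zero _).2 fun h => hc (eq_neg_of_add_eq_zero_left h))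
  have hdq : d ^ Fintype.card k = d := by rw [hd, ← map_pow, ← map_pow, FiniteField.pow_card]
  have hadd : (t + d) ^ Fintype.card k = t ^ Fintype.card k + d ^ Fintype.card k :=
    map_add (FiniteField.frobeniusAlgHom k F) t d
  have hu : P.ring.valuation (t + d) = 1 := by
    rw [Valuation.map_add_eq_of_lt_right _ (hd1.symm ▸ hz.2.1), hd1]
  have hpow : P.ring.valuation (1 - t ^ (Fintype.card k - 1)) = 1 := by
    have hlt : P.ring.valuation (t ^ (Fintype.card k - 1)) < P.ring.valuation 1 := by
      rw [map_pow, map_one]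
      exact pow_lt_one₀ zero_le hz.2.1 (by lia)
    rw [Valuation.map_sub_eq_of_lt_left _ hlt, map_one]
  refine hz.congr ?_
  -- The factor `t + d` raises the exponent to `q`, where Frobenius is additive and `d ^ q = d`
  -- cancels `d`.
  have key : (t + d) * (1 - (z + 1) ^ (Fintype.card k - 1)) =
      t * (1 - t ^ (Fintype.card k - 1)) := by
    rw [hzt, mul_sub, mul_sub, mul_pow_sub_one (by lia), mul_pow_sub_one (by lia), hadd, hdq]
    ring
  have := congrArg P.ring.valuation key
  rwa [map_mul, map_mul, hu, hpow, one_mul, mul_one] at this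

end FunctionFieldPlace

/-! ### Generators of the tower and the induction along it. -/

section Tower

variable {K E : Type*} [Field K] [Field E] [Algebra K E] (x : ℕ → E)

theorem adjoin_towerField_zero :
    IntermediateField.adjoin K {(⟨x 0, mem_towerField K x le_rfl⟩ : towerField K x 0)} = ⊤ := by
  refine IntermediateField.map_injective (towerField K x 0).val ?_
  rw [IntermediateField.adjoin_map, ← AlgHom.fieldRange_eq_map, IntermediateField.fieldRange_val,
    Set.image_singleton]
  refine le_antisymm (IntermediateField.adjoin_le_iff.2 ?_) (IntermediateField.adjoin_le_iff.2 ?_)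
  · rintro _ rfl
    exact mem_towerField K x le_rfl
  · rintro _ ⟨i, hi, rfl⟩
    rw [Nat.le_zero.1 hi]
    exact IntermediateField.mem_adjoin_simple_self K (x 0)

theorem IntermediateField.adjoin_singleton_eq_top_of_le {A B : IntermediateField K E} (h : A ≤ B)
    {y : B} (hB : B ≤ A ⊔ IntermediateField.adjoin K {(y : E)}) :
    letI := (IntermediateField.inclusion h : A →+* B).toAlgebra
    IntermediateField.adjoin A {y} = ⊤ := by
  let _ : Algebra A B := (IntermediateField.inclusion h : A →+* B).toAlgebra
  have : IsScalarTower K A B :=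
    .of_algebraMap_eq fun a => ((IntermediateField.inclusion h).commutes a).symm
  -- `A(y)` viewed inside `E`; it contains both `A` and `K(y)`, hence all of `B`.
  let L : IntermediateField K E := ((IntermediateField.adjoin A {y}).restrictScalars K).map B.val
  have hA : A ≤ L := fun a ha =>
    ⟨⟨a, h ha⟩, (IntermediateField.adjoin A {y}).algebraMap_mem ⟨a, ha⟩, rfl⟩
  have hy : IntermediateField.adjoin K {(y : E)} ≤ L := by
    refine IntermediateField.adjoin_le_iff.2 ?_
    rintro _ rfl
    exact ⟨y, IntermediateField.mem_adjoin_simple_self A y, rfl⟩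
  refine eq_top_iff.2 fun z _ => ?_
  obtain ⟨w, hw, hwz⟩ := hB.trans (sup_le hA hy) z.2
  exact (Subtype.ext hwz : w = z) ▸ hw

theorem towerField_succ_le (n : ℕ) :
    towerField K x (n + 1) ≤ towerField K x n ⊔ IntermediateField.adjoin K {x (n + 1)} := by
  refine IntermediateField.adjoin_le_iff.2 ?_
  rintro _ ⟨i, hi, rfl⟩
  obtain hi | rfl := Nat.le_succ_iff.1 hi
  · exact (le_sup_left : towerField K x n ≤ _) (mem_towerField K x hi)
  · exact (le_sup_right : _ ≤ towerField K x n ⊔ _)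
      (IntermediateField.mem_adjoin_simple_self K _)

theorem adjoin_towerField_succ (n : ℕ) :
    letI := (towerInclusion K x (Nat.le_succ n) :
      towerField K x n →+* towerField K x (n + 1)).toAlgebra
    IntermediateField.adjoin (towerField K x n)
      {(⟨x (n + 1), mem_towerField K x le_rfl⟩ : towerField K x (n + 1))} = ⊤ :=
  IntermediateField.adjoin_singleton_eq_top_of_le (towerField_mono K x (Nat.le_succ n))
    (towerField_succ_le x n)

theorem pow_eq_towerInclusion {n m : ℕ} (h : x (n + 1) ^ m + (x n + 1) ^ m = 1) :
    (⟨x (n + 1), mem_towerField K x le_rfl⟩ : towerField K x (n + 1)) ^ m =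
      towerInclusion K x (Nat.le_succ n)
        (1 - ((⟨x n, mem_towerField K x le_rfl⟩ : towerField K x n) + 1) ^ m) := by
  refine Subtype.ext ?_
  rw [towerInclusion, IntermediateField.coe_inclusion]
  push_cast
  exact eq_sub_of_add_eq h

end Tower

/-- The invariant of the induction: `c = α` at level 0 and `c = 0` from level 1 on. Keeping `c`
general lets one computation serve both cases. -/
theorem isUniformizer_towerField
    {k K E : Type*} [Field k] [Field K] [Field E] [Finite k] [Algebra k K] [Algebra K E]
    (x : ℕ → E) (hx0 : Transcendental K (x 0))
    (hx : ∀ i : ℕ, x (i + 1) ^ (Nat.card k - 1) + (x i + 1) ^ (Nat.card k - 1) = 1)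
    {α : k} (hα : α ≠ -1)
    (Pα : FunctionFieldPlace K (towerField K x 0))
    (hPα : Pα.IsZero
      ((⟨x 0, mem_towerField K x le_rfl⟩ : towerField K x 0) -
        algebraMap K (towerField K x 0) (algebraMap k K α)))
    (n : ℕ) (P : FunctionFieldPlace K (towerField K x n))
    (hP : FunctionFieldPlace.LiesAbove (towerInclusion K x (Nat.zero_le n)) P Pα) :
    ∃ c : k, c ≠ -1 ∧ P.ring.IsUniformizer
      ((⟨x n, mem_towerField K x le_rfl⟩ : towerField K x n) -
        algebraMap K (towerField K x n) (algebraMap k K c)) := by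
  have hq : Nat.card k - 1 ≠ 0 := by
    have := Finite.one_lt_card (α := k)
    lia
  induction n with
  | zero =>
    refine ⟨α, hα, P.isUniformizer_of_transcendental ?_ ?_ ?_⟩
    · intro h
      have h' := (h.add (isAlgebraic_algebraMap (algebraMap k K α)))
      rw [sub_add_cancel] at h'
      exact hx0 (h'.algHom (towerField K x 0).val)
    · rw [IntermediateField.adjoin_simple_sub_algebraMap]
      exact adjoin_towerField_zero x
    · obtain rfl : P = Pα := FunctionFieldPlace.eq_of_ring_eq hP
      obtain ⟨h, hm⟩ := hPα
      exact (P.ring.valuation_lt_one_iff _).1 hm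
  | succ n ih =>
    have hcomp : (towerInclusion K x (Nat.le_succ n)).comp (towerInclusion K x (Nat.zero_le n)) =
        towerInclusion K x (Nat.zero_le (n + 1)) := AlgHom.ext fun _ => rfl
    rw [← hcomp] at hP
    -- The induction hypothesis applies to the restriction of `P` to `F_n`, where `x_{n+1} ^ (q -
    -- 1)` is a uniformizer.
    obtain ⟨P', hPP', hP'⟩ := hP.exists_of_comp
    obtain ⟨c, hc, huc⟩ := ih P' hP'
    refine ⟨0, (neg_ne_zero.2 one_ne_zero).symm, ?_⟩
    rw [map_zero, map_zero, sub_zero]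
    exact hPP'.isUniformizer_of_pow_eq (P'.isUniformizer_one_sub_pow hc huc) hq
      (pow_eq_towerInclusion x (hx n)) (adjoin_towerField_succ x n)

theorem proposition2p2
    {k K E : Type*} [Field k] [Field K] [Field E] [Finite k] [Finite K] [Algebra k K] [Algebra K E]
    (q : ℕ) (hq : Nat.card k = q) (hq2 : 2 < q)
    (x : ℕ → E) (hx0 : Transcendental K (x 0))
    (hx : ∀ i : ℕ, x (i + 1) ^ (q - 1) + (x i + 1) ^ (q - 1) = 1)
    (α : k) (hα : α ≠ -1)
    (Pα : FunctionFieldPlace K (towerField K x 0))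
    (hPα : Pα.IsZero
      ((⟨x 0, mem_towerField K x le_rfl⟩ : towerField K x 0) -
        algebraMap K (towerField K x 0) (algebraMap k K α)))
    (n : ℕ) :
    ∀ P : FunctionFieldPlace K (towerField K x n),
      FunctionFieldPlace.LiesAbove (towerInclusion K x (Nat.zero_le n)) P Pα →
        FunctionFieldPlace.IsTotallyRamified (towerInclusion K x (Nat.le_succ n)) P := by
  subst hq
  intro P hP
  obtain ⟨c, hc, huc⟩ := isUniformizer_towerField x hx0 hx hα Pα hPα n P hP
  exact P.isTotallyRamified_of_pow_eq _ (P.isUniformizer_one_sub_pow hc huc) (by lia)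
    (pow_eq_towerInclusion x (hx n)) (adjoin_towerField_succ x n)
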